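/- For a permutation $\sigma=\sigma_1\cdots\sigma_N$ of $[N]=\{1,\dots,N\}$ let $\mathrm{des}\,\sigma$ be the number of descents $\sigma_i>\sigma_{i+1}$ ($1\le i<N$); $\sigma_i$ and $\sigma_{i+1}$ are then a descent top and a descent bottom. Let $\mathrm{lema}\,\sigma$ and $\mathrm{loma}\,\sigma$ be the numbers of even and of odd left-to-right maxima. Let $\mathrm{les}\,\sigma$ be the number of pairs $(i,j)$ with $2\le i<j\le N$ and $\sigma_{i-1}>\sigma_j>\sigma_i$; let $\mathrm{ress}\,\sigma$ be the number of pairs $1\le i<j\le N-1$ with $\sigma_j>\sigma_i>\sigma_{j+1}$; and let $\mathrm{res}\,\sigma$ be the number of pairs $1\le i<j\le N-1$ with $\sigma_{j+1}>\sigma_i>\sigma_j$. For a value $v$, let $\mathrm{les}_\sigma(v)$ be the number of pairs counted by $\mathrm{les}\,\sigma$ with $\sigma_j=v$, and let $\mathrm{ress}_\sigma(v)$, $\mathrm{res}_\sigma(v)$ be the numbers of pairs counted by $\mathrm{ress}\,\sigma$, $\mathrm{res}\,\sigma$ with $\sigma_i=v$. *E-permutations.* An E-permutation is a permutation $\sigma$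 of $[2n]$ all of whose descents have an even top and an odd bottom, and such that for no $j\in[n]$ are $2j-1$ and $2j$ simultaneously a descent bottom and a descent top. Let $S$ be the set of descent tops and bottoms of $\sigma$, and put $s(x)=S_o(x)-S_e(x)+\varepsilon(x)$, where $S_o(x)$ and $S_e(x)$ are the numbers of odd and of even elements of $S$ less than $x$, and $\varepsilon(x)=1$ if $x\notin S$ or $x$ is odd, $\varepsilon(x)=0$ otherwise. The E-permutation $\sigma$ is normalized if for every $j\in[n]$: (a) if $2j-1\in S$ and $s(2j-1)$ is odd, then $\mathrm{les}_\sigma(2j)$ is even; (b) if $2j-1\in S$ and $s(2j-1)$ is even, then $\mathrm{les}_\sigma(2j-1)$ is even; (c) if $2j\in S$ and $s(2j)$ is odd, then $\mathrm{ress}_\sigma(2j-1)$ is even; (d) if $2j\in S$ and $s(2j)$ is even, then $\mathrm{ress}_\sigma(2j)$ is even. *F-permutations.* For a permutation $\sigma$ of $[2n+1]$ put $\sigma_0=\sigma_{2n+2}=0$, and call $\sigma_i$ a peak if $\sigma_{i-1}<\sigma_i>\sigma_{i+1}$, a valley if $\sigma_{i-1}>\sigma_i<\sigma_{i+1}$,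 and a double descent if $\sigma_{i-1}>\sigma_i>\sigma_{i+1}$. An F-permutation is a permutation $\sigma$ of $[2n+1]$ all of whose descents have an odd top and an odd bottom, which ends with an odd entry, has no double descent, and whose last entry is a peak. Let $a(j)=f(j)-g(j)+1$, where $f(j)$ and $g(j)$ are the numbers of valleys and of peaks less than $j$. The F-permutation $\sigma$ is normalized if for every $i\in[n]$ such that $2i-1$ is a valley or a peak: $\mathrm{res}_\sigma(2i-1)$ is even when $a(2i-1)$ is even, and $\mathrm{les}_\sigma(2i)$ is even when $a(2i-1)$ is odd. Let $$\overline X_n(a,\bar a,p,q,t)=\sum_{\sigma}a^{\mathrm{lema}\,\sigma}\bar a^{\mathrm{loma}\,\sigma}p^{\mathrm{ress}\,\sigma}q^{\mathrm{les}\,\sigma}t^{\mathrm{des}\,\sigma},\qquad \overline Y_n(a,p,q,t)=\sum_{\tau}a^{\mathrm{lema}\,\tau}p^{\mathrm{res}\,\tau}q^{\mathrm{les}\,\tau}t^{\mathrm{des}\,\tau},$$ where $\sigma$ runs over the E-permutations of $[2n]$ and $\tau$ over the F-permutations of $[2n+1]$. Let $\widehat X_n(a,\bar a,p,q,t)$ be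 the same sum as $\overline X_n$, restricted to normalized E-permutations, and let $\widehat Y_n(p,q,t)=\sum_\tau p^{\mathrm{res}\,\tau}q^{\mathrm{les}\,\tau}t^{\mathrm{des}\,\tau}$ over the normalized F-permutations $\tau$ of $[2n+1]$. Corollary. For every $n\ge 0$, $$\overline Y_n(a,p,q,t)=\overline X_n(a,1,p,q,t)\qquad\text{and}\qquad \widehat Y_n(p,q,t)=\widehat X_n(1,1,p,q,t).$$ -/

import Mathlib

namespace EvenOddDrop

variable {N : ℕ}

/-- The `i`-th entry of the word `σ₁ σ₂ … σ_N` of a permutation `σ` of `{1, …, N}`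
(with `{1, …, N}` modelled on `Fin N`), with the convention `σ₀ = σ_{N+1} = 0`. -/
def entry (σ : Equiv.Perm (Fin N)) (i : ℕ) : ℕ :=
  if h : 1 ≤ i ∧ i ≤ N then (σ ⟨i - 1, by omega⟩ : ℕ) + 1 else 0

/-! ### Statistics -/

/-- Number of descents `σ_i > σ_{i+1}`, `1 ≤ i ≤ N - 1`. -/
def des (σ : Equiv.Perm (Fin N)) : ℕ :=
  ((Finset.Ico 1 N).filter fun i => entry σ (i + 1) < entry σ i).card

/-- `σ_i` is a left-to-right maximum. -/
def IsLRMaxAt (σ : Equiv.Perm (Fin N)) (i : ℕ) : Prop :=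
  ∀ j ∈ Finset.Ico 1 i, entry σ j < entry σ i

instance (σ : Equiv.Perm (Fin N)) : DecidablePred (IsLRMaxAt σ) :=
  fun i => by unfold IsLRMaxAt; infer_instance

/-- Number of even left-to-right maxima. -/
def lema (σ : Equiv.Perm (Fin N)) : ℕ :=
  ((Finset.Icc 1 N).filter fun i => IsLRMaxAt σ i ∧ Even (entry σ i)).card

/-- Number of odd left-to-right maxima. -/
def loma (σ : Equiv.Perm (Fin N)) : ℕ :=
  ((Finset.Icc 1 N).filter fun i => IsLRMaxAt σ i ∧ Odd (entry σ i)).card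

/-- Pairs `(i, j)` with `2 ≤ i < j ≤ N` and `σ_{i-1} > σ_j > σ_i`. -/
def lesPairs (σ : Equiv.Perm (Fin N)) : Finset (ℕ × ℕ) :=
  (Finset.Icc 1 N ×ˢ Finset.Icc 1 N).filter fun x =>
    2 ≤ x.1 ∧ x.1 < x.2 ∧ entry σ x.2 < entry σ (x.1 - 1) ∧ entry σ x.1 < entry σ x.2

/-- Pairs `(i, j)` with `1 ≤ i < j ≤ N - 1` and `σ_j > σ_i > σ_{j+1}`. -/
def ressPairs (σ : Equiv.Perm (Fin N)) : Finset (ℕ × ℕ) :=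
  (Finset.Icc 1 N ×ˢ Finset.Icc 1 N).filter fun x =>
    x.1 < x.2 ∧ x.2 + 1 ≤ N ∧ entry σ x.1 < entry σ x.2 ∧ entry σ (x.2 + 1) < entry σ x.1

/-- Pairs `(i, j)` with `1 ≤ i < j ≤ N - 1` and `σ_{j+1} > σ_i > σ_j`. -/
def resPairs (σ : Equiv.Perm (Fin N)) : Finset (ℕ × ℕ) :=
  (Finset.Icc 1 N ×ˢ Finset.Icc 1 N).filter fun x =>
    x.1 < x.2 ∧ x.2 + 1 ≤ N ∧ entry σ x.1 < entry σ (x.2 + 1) ∧ entry σ x.2 < entry σ x.1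

/-- The number of occurrences of the pattern `31-2`. -/
def les (σ : Equiv.Perm (Fin N)) : ℕ := (lesPairs σ).card

/-- The number of occurrences of the pattern `2-31`; the statistic `res` of permutations
with only even-odd descents. -/
def ress (σ : Equiv.Perm (Fin N)) : ℕ := (ressPairs σ).card

/-- The number of occurrences of the pattern `2-13`; the statistic `res` of permutations
with only odd-odd descents. -/
def res (σ : Equiv.Perm (Fin N)) : ℕ := (resPairs σ).card

/-- The number of left embracings of the value `v`: pairs of `lesPairs σ` with `σ_j = v`. -/
def lesAt (σ : Equiv.Perm (Fin N)) (v : ℕ) : ℕ :=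
  ((lesPairs σ).filter fun x => entry σ x.2 = v).card

/-- The number of right embracings of the value `v`: pairs of `ressPairs σ` with `σ_i = v`. -/
def ressAt (σ : Equiv.Perm (Fin N)) (v : ℕ) : ℕ :=
  ((ressPairs σ).filter fun x => entry σ x.1 = v).card

/-- The contribution of the value `v` to `res`: pairs of `resPairs σ` with `σ_i = v`. -/
def resAt (σ : Equiv.Perm (Fin N)) (v : ℕ) : ℕ :=
  ((resPairs σ).filter fun x => entry σ x.1 = v).card

/-! ### Even-odd descent permutations and `E`-permutations -/

/-- The value `v` is a descent top. -/
def IsDescentTop (σ : Equiv.Perm (Fin N)) (v : ℕ) : Prop :=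
  ∃ i ∈ Finset.Ico 1 N, entry σ i = v ∧ entry σ (i + 1) < entry σ i

/-- The value `v` is a descent bottom. -/
def IsDescentBottom (σ : Equiv.Perm (Fin N)) (v : ℕ) : Prop :=
  ∃ i ∈ Finset.Ico 1 N, entry σ (i + 1) = v ∧ entry σ (i + 1) < entry σ i

instance (σ : Equiv.Perm (Fin N)) : DecidablePred (IsDescentTop σ) :=
  fun v => by unfold IsDescentTop; infer_instance

instance (σ : Equiv.Perm (Fin N)) : DecidablePred (IsDescentBottom σ) :=
  fun v => by unfold IsDescentBottom; infer_instance

/-- All descents have an even top and an odd bottom. -/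
def IsEvenOddDescent (σ : Equiv.Perm (Fin N)) : Prop :=
  ∀ i ∈ Finset.Ico 1 N, entry σ (i + 1) < entry σ i →
    Even (entry σ i) ∧ Odd (entry σ (i + 1))

instance : DecidablePred (IsEvenOddDescent (N := N)) :=
  fun σ => by unfold IsEvenOddDescent; infer_instance

/-- `E`-permutations: even-odd descent permutations of `{1, …, 2n}` such that for no
`j ∈ {1, …, n}` are `2j - 1` and `2j` simultaneously a descent bottom and a descent top. -/
def IsEPerm (n : ℕ) (σ : Equiv.Perm (Fin (2 * n))) : Prop :=
  IsEvenOddDescent σ ∧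
    ∀ j ∈ Finset.Icc 1 n, ¬ (IsDescentBottom σ (2 * j - 1) ∧ IsDescentTop σ (2 * j))

instance (n : ℕ) : DecidablePred (IsEPerm n) :=
  fun σ => by unfold IsEPerm; infer_instance

/-- The set `S_σ` of descent tops and descent bottoms. -/
def signature (σ : Equiv.Perm (Fin N)) : Finset ℕ :=
  (Finset.Icc 1 N).filter fun v => IsDescentTop σ v ∨ IsDescentBottom σ v

/-- The signature function
`s(x) = S_o(x) - S_e(x) + (1 if x is an odd element of S or x ∉ S)`, where `S_o(x)`, `S_e(x)`
count the odd and the even elements of `S = S_σ` less than `x`. -/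
def sig (σ : Equiv.Perm (Fin N)) (x : ℕ) : ℤ :=
  (((signature σ).filter fun v => Odd v ∧ v < x).card : ℤ)
    - (((signature σ).filter fun v => Even v ∧ v < x).card : ℤ)
    + (if (x ∈ signature σ ∧ Odd x) ∨ x ∉ signature σ then 1 else 0)

/-- Normalized `E`-permutations. -/
def IsNormalizedEPerm (n : ℕ) (σ : Equiv.Perm (Fin (2 * n))) : Prop :=
  IsEPerm n σ ∧ ∀ j ∈ Finset.Icc 1 n,
    (2 * j - 1 ∈ signature σ → Odd (sig σ (2 * j - 1)) → Even (lesAt σ (2 * j))) ∧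
    (2 * j - 1 ∈ signature σ → Even (sig σ (2 * j - 1)) → Even (lesAt σ (2 * j - 1))) ∧
    (2 * j ∈ signature σ → Odd (sig σ (2 * j)) → Even (ressAt σ (2 * j - 1))) ∧
    (2 * j ∈ signature σ → Even (sig σ (2 * j)) → Even (ressAt σ (2 * j)))

instance (n : ℕ) : DecidablePred (IsNormalizedEPerm n) :=
  fun σ => by unfold IsNormalizedEPerm; infer_instance

/-! ### Odd-odd descent permutations and `F`-permutations -/

/-- The value `v` is a peak (with `σ₀ = σ_{N+1} = 0`). -/
def IsPeak (σ : Equiv.Perm (Fin N)) (v : ℕ) : Prop :=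
  ∃ i ∈ Finset.Icc 1 N, entry σ i = v ∧
    entry σ (i - 1) < entry σ i ∧ entry σ (i + 1) < entry σ i

/-- The value `v` is a valley (with `σ₀ = σ_{N+1} = 0`). -/
def IsValley (σ : Equiv.Perm (Fin N)) (v : ℕ) : Prop :=
  ∃ i ∈ Finset.Icc 1 N, entry σ i = v ∧
    entry σ i < entry σ (i - 1) ∧ entry σ i < entry σ (i + 1)

/-- The value `v` is a double descent (with `σ₀ = σ_{N+1} = 0`). -/
def IsDoubleDescent (σ : Equiv.Perm (Fin N)) (v : ℕ) : Prop :=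
  ∃ i ∈ Finset.Icc 1 N, entry σ i = v ∧
    entry σ i < entry σ (i - 1) ∧ entry σ (i + 1) < entry σ i

instance (σ : Equiv.Perm (Fin N)) : DecidablePred (IsPeak σ) :=
  fun v => by unfold IsPeak; infer_instance

instance (σ : Equiv.Perm (Fin N)) : DecidablePred (IsValley σ) :=
  fun v => by unfold IsValley; infer_instance

instance (σ : Equiv.Perm (Fin N)) : DecidablePred (IsDoubleDescent σ) :=
  fun v => by unfold IsDoubleDescent; infer_instance

/-- All descents have an odd top and an odd bottom. -/
def IsOddOddDescent (σ : Equiv.Perm (Fin N)) : Prop :=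
  ∀ i ∈ Finset.Ico 1 N, entry σ (i + 1) < entry σ i →
    Odd (entry σ i) ∧ Odd (entry σ (i + 1))

instance : DecidablePred (IsOddOddDescent (N := N)) :=
  fun σ => by unfold IsOddOddDescent; infer_instance

/-- `F`-permutations: odd-odd descent permutations of `{1, …, 2n+1}` ending with an odd
entry, without double descents, and whose last entry is a peak. -/
def IsFPerm (n : ℕ) (σ : Equiv.Perm (Fin (2 * n + 1))) : Prop :=
  IsOddOddDescent σ ∧ Odd (entry σ (2 * n + 1)) ∧
    (∀ v ∈ Finset.Icc 1 (2 * n + 1), ¬ IsDoubleDescent σ v) ∧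
    IsPeak σ (entry σ (2 * n + 1))

instance (n : ℕ) : DecidablePred (IsFPerm n) :=
  fun σ => by unfold IsFPerm; infer_instance

/-- `a(j) = f(j) - g(j) + 1`, where `f(j)`, `g(j)` are the numbers of valleys and of peaks
of `σ` that are less than `j`. -/
def levelAt (σ : Equiv.Perm (Fin N)) (j : ℕ) : ℤ :=
  (((Finset.Icc 1 N).filter fun v => IsValley σ v ∧ v < j).card : ℤ)
    - (((Finset.Icc 1 N).filter fun v => IsPeak σ v ∧ v < j).card : ℤ) + 1

/-- `{2i-1, 2i}` is a VOP pair: `2i - 1` is a valley or a peak. -/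
def IsVOP (σ : Equiv.Perm (Fin N)) (i : ℕ) : Prop :=
  IsValley σ (2 * i - 1) ∨ IsPeak σ (2 * i - 1)

instance (σ : Equiv.Perm (Fin N)) : DecidablePred (IsVOP σ) :=
  fun v => by unfold IsVOP; infer_instance

/-- The embracing number of the VOP pair `{2i-1, 2i}`. -/
def vopEmbracing (σ : Equiv.Perm (Fin N)) (i : ℕ) : ℕ :=
  if Even (levelAt σ (2 * i - 1)) then resAt σ (2 * i - 1) else lesAt σ (2 * i)

/-- Normalized `F`-permutations: the embracing number of every VOP pair is even. -/
def IsNormalizedFPerm (n : ℕ) (σ : Equiv.Perm (Fin (2 * n + 1))) : Prop :=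
  IsFPerm n σ ∧ ∀ i ∈ Finset.Icc 1 n, IsVOP σ i → Even (vopEmbracing σ i)

instance (n : ℕ) : DecidablePred (IsNormalizedFPerm n) :=
  fun σ => by unfold IsNormalizedFPerm; infer_instance

/-! ### Generating polynomials

The variables take values in an arbitrary commutative semiring; the formal polynomials are
obtained by taking indeterminates of a polynomial ring. -/

variable {R : Type*} [CommSemiring R]

/-- Generating polynomial of `E`-permutations by `lema`, `loma`, `res`, `les`, `des`. -/
def Xbar (n : ℕ) (a a' p q t : R) : R :=
  ∑ σ ∈ (Finset.univ : Finset (Equiv.Perm (Fin (2 * n)))).filter (IsEPerm n),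
    a ^ lema σ * a' ^ loma σ * p ^ ress σ * q ^ les σ * t ^ des σ

/-- Generating polynomial of normalized `E`-permutations. -/
def Xhat (n : ℕ) (a a' p q t : R) : R :=
  ∑ σ ∈ (Finset.univ : Finset (Equiv.Perm (Fin (2 * n)))).filter (IsNormalizedEPerm n),
    a ^ lema σ * a' ^ loma σ * p ^ ress σ * q ^ les σ * t ^ des σ

/-- Generating polynomial of `F`-permutations by `lema`, `res`, `les`, `des`. -/
def Ybar (n : ℕ) (a p q t : R) : R :=
  ∑ σ ∈ (Finset.univ : Finset (Equiv.Perm (Fin (2 * n + 1)))).filter (IsFPerm n),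
    a ^ lema σ * p ^ res σ * q ^ les σ * t ^ des σ

/-- Generating polynomial of normalized `F`-permutations by `res`, `les`, `des`. -/
def Yhat (n : ℕ) (p q t : R) : R :=
  ∑ σ ∈ (Finset.univ : Finset (Equiv.Perm (Fin (2 * n + 1)))).filter (IsNormalizedFPerm n),
    p ^ res σ * q ^ les σ * t ^ des σ

end EvenOddDrop

/-!
Insert the values `1, …, N` of a permutation one after the other. The values less than `v` form
blocks of consecutive letters; the value `v` opens a new block (a valley), extends a block on the
right or on the left, or joins two blocks (a peak), and its left embracing number says where. This
encodes a permutation as a Laguerre history, a list of steps in which the shape of each value moves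
a height and the height bounds the embracing numbers. The statistics `les`, `res`, `ress`, `des` and
`lema` are sums of local contributions of the steps. A permutation can be recovered from its
history, and there are `N!` histories, so every history occurs.

The words relevant for `E`-permutations are followed by a virtual letter `N + 1`, those relevant for
`F`-permutations by `0`. Both kinds of permutations, and the normalized ones, are then singled out
by a condition on the pairs of steps that insert `2j - 1` and `2j`, and each pair moves the height
by `1`, `0` or `-1`. All four generating polynomials are therefore weighted sums over Motzkin paths.
Such a sum depends only on the weights of the level steps and on the products of the weights of the
up steps and of the matching down steps. Without normalization the weights of the steps agree; with
it, at every other height, a factor of the up step trades places with one of the down step.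
-/

namespace EvenOddDrop

open Finset

/-! ### Level crossings of words -/

/-- The number of descents `w (i + 1) < x ≤ w i` with `i < m`. -/
def downCross (w : ℕ → ℕ) (x m : ℕ) : ℕ :=
  Nat.count (fun i => w (i + 1) < x ∧ x ≤ w i) m

/-- The number of descents `w (i + 1) < x < w i` with `i < m`. -/
def strictDownCross (w : ℕ → ℕ) (x m : ℕ) : ℕ :=
  Nat.count (fun i => w (i + 1) < x ∧ x < w i) m

/-- The number of ascents `w i < x ≤ w (i + 1)` with `i < m`. -/
def upCross (w : ℕ → ℕ) (x m : ℕ) : ℕ :=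
  Nat.count (fun i => w i < x ∧ x ≤ w (i + 1)) m

section Crossings

variable {w : ℕ → ℕ} {x m : ℕ}

lemma downCross_succ : downCross w x (m + 1) =
    downCross w x m + if w (m + 1) < x ∧ x ≤ w m then 1 else 0 :=
  Nat.count_succ ..

lemma strictDownCross_succ : strictDownCross w x (m + 1) =
    strictDownCross w x m + if w (m + 1) < x ∧ x < w m then 1 else 0 :=
  Nat.count_succ ..

lemma upCross_succ : upCross w x (m + 1) =
    upCross w x m + if w m < x ∧ x ≤ w (m + 1) then 1 else 0 :=
  Nat.count_succ ..

lemma downCross_mono (w : ℕ → ℕ) (x : ℕ) : Monotone (downCross w x) := Nat.count_monotone _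

lemma strictDownCross_mono (w : ℕ → ℕ) (x : ℕ) : Monotone (strictDownCross w x) :=
  Nat.count_monotone _

lemma downCross_add_eq_upCross_add (w : ℕ → ℕ) (x m : ℕ) :
    downCross w x m + (if x ≤ w m then 1 else 0) =
      upCross w x m + (if x ≤ w 0 then 1 else 0) := by
  induction m with
  | zero => simp [downCross, upCross]
  | succ m ih =>
    rw [downCross_succ, upCross_succ]
    split_ifs at ih ⊢ <;> omega

lemma downCross_lt_downCross {a b : ℕ} (hab : a ≤ b) (ha : x ≤ w a) (hb : w b < x) :
    downCross w x a < downCross w x b := by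
  induction b, hab using Nat.le_induction with
  | base => omega
  | succ b hab ih =>
    rw [downCross_succ]
    by_cases hb' : w b < x
    · exact Nat.lt_add_right _ (ih hb')
    · rw [if_pos ⟨hb, not_lt.1 hb'⟩]
      exact Nat.lt_succ_of_le (downCross_mono w x hab)

variable {v p : ℕ}

lemma downCross_eq_strictDownCross_add (hp : ∀ i, w i = v ↔ i = p) (m : ℕ) :
    downCross w v m = strictDownCross w v m + if p < m ∧ w (p + 1) < v then 1 else 0 := by
  induction m with
  | zero => simp [downCross, strictDownCross]
  | succ m ih =>
    rw [downCross_succ, strictDownCross_succ, ih]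
    have := hp m
    split_ifs <;> grind

lemma downCross_succ_eq_strictDownCross_add (hp : ∀ i, w i = v ↔ i = p) (hp₁ : 1 ≤ p) (m : ℕ) :
    downCross w (v + 1) m = strictDownCross w v m + if p ≤ m ∧ v < w (p - 1) then 1 else 0 := by
  induction m with
  | zero => simp [downCross, strictDownCross, Nat.one_le_iff_ne_zero.1 hp₁]
  | succ m ih =>
    rw [downCross_succ, strictDownCross_succ, ih]
    have := hp (m + 1)
    split_ifs <;> grind

lemma downCross_eq_strictDownCross_of_le {q : ℕ} (hp : ∀ i, w i = v ↔ i = p) (hq : q ≤ p) :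
    downCross w v q = strictDownCross w v q := by
  simp [downCross_eq_strictDownCross_add hp, hq.not_gt]

lemma lt_iff_strictDownCross_lt_downCross {q : ℕ} (hp : ∀ i, w i = v ↔ i = p) (hq : w q < v) :
    p < q ↔ strictDownCross w v p < downCross w v q := by
  refine ⟨fun hpq => ?_, fun h => ?_⟩
  · rw [← downCross_eq_strictDownCross_of_le hp le_rfl]
    exact downCross_lt_downCross hpq.le ((hp p).2 rfl).ge hq
  · by_contra! hqp
    exact h.not_ge (downCross_eq_strictDownCross_of_le hp hqp ▸ strictDownCross_mono w v hqp)

lemma forall_lt_iff_strictDownCross_eq_zero (hp : ∀ i, w i = v ↔ i = p) :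
    (∀ j < p, w j < v) ↔ ¬ v < w (p - 1) ∧ strictDownCross w v p = 0 := by
  rw [← downCross_eq_strictDownCross_of_le hp le_rfl]
  refine ⟨fun h => ⟨?_, ?_⟩, fun ⟨_, _⟩ j hj => ?_⟩
  · have := hp p
    have := h (p - 1)
    grind
  · exact Nat.count_iff_forall_not.2 fun i hi => by have := h i hi; omega
  · by_contra! hvj
    have := hp (p - 1)
    have hlt := downCross_lt_downCross (w := w) (a := j) (b := p - 1) (by omega) hvj (by omega)
    have := downCross_mono w v (Nat.sub_le p 1)
    omega

end Crossings

/-! ### Words of permutations -/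

variable {N : ℕ} {σ τ : Equiv.Perm (Fin N)} {c : Bool} {i u v : ℕ}

lemma entry_eq_apply_add_one (σ : Equiv.Perm (Fin N)) (hi : i ∈ Icc 1 N) :
    entry σ i = (σ ⟨i - 1, by grind⟩ : ℕ) + 1 :=
  dif_pos (mem_Icc.1 hi)

lemma entry_le (σ : Equiv.Perm (Fin N)) (i : ℕ) : entry σ i ≤ N := by
  unfold entry
  split_ifs with h <;> omega

lemma entry_eq_zero_of_notMem (σ : Equiv.Perm (Fin N)) (hi : i ∉ Icc 1 N) : entry σ i = 0 :=
  dif_neg fun h => hi (mem_Icc.2 h)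

lemma entry_mem_Icc (σ : Equiv.Perm (Fin N)) (hi : i ∈ Icc 1 N) : entry σ i ∈ Icc 1 N :=
  mem_Icc.2 ⟨by simp [entry_eq_apply_add_one σ hi], entry_le σ i⟩

/-- The position of the value `v` in the word of `σ`. -/
def pos (σ : Equiv.Perm (Fin N)) (v : ℕ) : ℕ := entry σ.symm v

lemma pos_mem_Icc (σ : Equiv.Perm (Fin N)) (hv : v ∈ Icc 1 N) : pos σ v ∈ Icc 1 N :=
  entry_mem_Icc _ hv

lemma entry_pos (σ : Equiv.Perm (Fin N)) (hv : v ∈ Icc 1 N) : entry σ (pos σ v) = v := by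
  rw [entry_eq_apply_add_one σ (pos_mem_Icc σ hv)]
  simp only [pos, entry_eq_apply_add_one σ.symm hv, Nat.add_sub_cancel, Fin.eta,
    Equiv.apply_symm_apply]
  grind

lemma pos_entry (σ : Equiv.Perm (Fin N)) (hi : i ∈ Icc 1 N) : pos σ (entry σ i) = i :=
  entry_pos σ.symm hi

lemma entry_eq_iff (hv : v ∈ Icc 1 N) : entry σ i = v ↔ i = pos σ v := by
  refine ⟨fun h => ?_, fun h => h ▸ entry_pos σ hv⟩
  by_cases hi : i ∈ Icc 1 N
  · rw [← h, pos_entry σ hi]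
  · grind [entry_eq_zero_of_notMem σ hi]

lemma pos_inj (hu : u ∈ Icc 1 N) (hv : v ∈ Icc 1 N) : pos σ u = pos σ v ↔ u = v := by
  rw [← entry_eq_iff hv, entry_pos σ hu]

/-- The word `0 σ₁ … σ_N` followed by `0` if `c` is true (a closed word), and by `N + 1`
otherwise (an open word); beyond, it vanishes. -/
def padded (c : Bool) (σ : Equiv.Perm (Fin N)) (i : ℕ) : ℕ :=
  if c = false ∧ i = N + 1 then N + 1 else entry σ i

lemma padded_true : padded true σ = entry σ := by
  funext i
  simp [padded]

lemma padded_false_last : padded false σ (N + 1) = N + 1 := by simp [padded]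

lemma padded_of_le (hi : i ≤ N) : padded c σ i = entry σ i := if_neg (by omega)

lemma padded_pos (hv : v ∈ Icc 1 N) : padded c σ (pos σ v) = v := by
  rw [padded_of_le (mem_Icc.1 (pos_mem_Icc σ hv)).2, entry_pos σ hv]

lemma padded_eq_iff (hv : v ∈ Icc 1 N) : padded c σ i = v ↔ i = pos σ v := by
  rw [← entry_eq_iff hv, padded]
  have := entry_eq_zero_of_notMem σ (i := N + 1) (by simp)
  split_ifs <;> grind

/-! ### Steps of a permutation -/

/-- How a value compares with its neighbours in a word: it is a descent bottom (`isBot`) if it is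
preceded by a larger entry, and a descent top (`isTop`) if it is followed by a smaller one. -/
@[ext]
structure Shape where
  isBot : Bool
  isTop : Bool
deriving DecidableEq, Fintype

namespace Shape

/-- Preceded and followed by larger entries. -/
@[simps] def valley : Shape := ⟨true, false⟩

/-- Preceded and followed by smaller entries. -/
@[simps] def peak : Shape := ⟨false, true⟩

/-- Preceded by a smaller and followed by a larger entry. -/
@[simps] def doubleAscent : Shape := ⟨false, false⟩

/-- Preceded by a larger and followed by a smaller entry. -/
@[simps] def doubleDescent : Shape := ⟨true, true⟩

lemma sum_univ {M : Type*} [AddCommMonoid M] (f : Shape → M) :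
    ∑ x, f x = f valley + f doubleAscent + f peak + f doubleDescent := by
  have huniv : (univ : Finset Shape) = {valley, doubleAscent, peak, doubleDescent} := by decide
  simp [huniv, Shape.ext_iff, add_assoc]

end Shape

/-- A step of a Laguerre history: the shape of the inserted value and its left embracing number. -/
abbrev Step := (_ : Shape) × ℕ

/-- The shape of the value `v` of `σ`, with the boundary convention of `padded`. -/
def shape (c : Bool) (σ : Equiv.Perm (Fin N)) (v : ℕ) : Shape where
  isBot := decide (v < padded c σ (pos σ v - 1))
  isTop := decide (padded c σ (pos σ v + 1) < v)

/-- The step of the Laguerre history of `σ` that inserts the value `v`. -/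
def step (c : Bool) (σ : Equiv.Perm (Fin N)) (v : ℕ) : Step := ⟨shape c σ v, lesAt σ v⟩

/-- The number of descents of the padded word crossing the level `v`, which is the number of
maximal blocks of letters less than `v` other than the block of the initial letter `0`. -/
def height (c : Bool) (σ : Equiv.Perm (Fin N)) (v : ℕ) : ℕ := downCross (padded c σ) v (N + 1)

lemma isBot_shape_eq_true : (shape c σ v).isBot = true ↔ v < padded c σ (pos σ v - 1) :=
  decide_eq_true_iff

lemma isTop_shape_eq_true : (shape c σ v).isTop = true ↔ padded c σ (pos σ v + 1) < v :=
  decide_eq_true_iff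

lemma isBot_shape_last : (shape c σ N).isBot = false := by
  have hpos : pos σ N ≤ N := entry_le _ _
  have := entry_le σ (pos σ N - 1)
  rw [Bool.eq_false_iff, Ne, isBot_shape_eq_true, padded_of_le (by omega)]
  omega

/-- The height after a step of shape `x`. -/
def next (h : ℕ) (x : Shape) : ℕ := h + x.isBot.toNat - x.isTop.toNat

lemma height_succ_add (hv : v ∈ Icc 1 N) :
    height c σ (v + 1) + (shape c σ v).isTop.toNat =
      height c σ v + (shape c σ v).isBot.toNat := by
  have hp := mem_Icc.1 (pos_mem_Icc σ hv)
  have hw := fun i => padded_eq_iff (c := c) (σ := σ) (i := i) hv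
  rw [height, height, downCross_succ_eq_strictDownCross_add hw hp.1,
    downCross_eq_strictDownCross_add hw]
  simp only [shape, Bool.toNat, Bool.cond_decide]
  grind

lemma height_succ (hv : v ∈ Icc 1 N) :
    height c σ (v + 1) = next (height c σ v) (shape c σ v) := by
  have := height_succ_add (c := c) (σ := σ) hv
  unfold next
  omega

lemma height_last : height c σ (N + 1) = 0 := by
  refine Nat.count_iff_forall_not.2 fun i hi => ?_
  rw [padded_of_le (Nat.lt_succ_iff.1 hi)]
  have := entry_le σ i
  omega

lemma height_one (hN : c.toNat ≤ N) : height c σ 1 = c.toNat := by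
  have hbelow : downCross (padded c σ) 1 N = 0 := Nat.count_iff_forall_not.2 fun i hi => by
    rw [padded_of_le hi]
    have := entry_mem_Icc σ (i := i + 1) (by grind)
    grind
  rw [height, downCross_succ, hbelow, zero_add]
  cases c with
  | false => simp [padded_false_last]
  | true =>
    have := entry_mem_Icc σ (i := N) (by grind)
    have := entry_eq_zero_of_notMem σ (i := N + 1) (by simp)
    rw [padded_true]
    grind

/-! ### Embracing numbers -/

lemma count_add_card_filter_Ico (P : ℕ → Prop) [DecidablePred P] {a b : ℕ} (hab : a ≤ b) :
    Nat.count P a + #{i ∈ Ico a b | P i} = Nat.count P b := by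
  simp only [Nat.count_eq_card_filter_range, card_filter]
  exact sum_range_add_sum_Ico _ hab

lemma lesAt_eq_strictDownCross (c : Bool) (hv : v ∈ Icc 1 N) :
    lesAt σ v = strictDownCross (padded c σ) v (pos σ v) := by
  have hp := pos_mem_Icc σ hv
  have hpos := fun i => entry_eq_iff (σ := σ) (i := i) hv
  have h0 := entry_eq_zero_of_notMem σ (i := 0) (by simp)
  rw [strictDownCross, Nat.count_eq_card_filter_range]
  refine card_bij' (fun x _ => x.1 - 1) (fun i _ => (i + 1, pos σ v)) ?_ ?_ ?_ ?_
  all_goals grind [lesPairs, padded]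

lemma strictDownCross_add_ressAt (hv : v ∈ Icc 1 N) :
    strictDownCross (padded false σ) v (pos σ v) + ressAt σ v =
      strictDownCross (padded false σ) v (N + 1) := by
  have hp := mem_Icc.1 (pos_mem_Icc σ hv)
  have hpos := fun i => entry_eq_iff (σ := σ) (i := i) hv
  rw [strictDownCross, strictDownCross, ← count_add_card_filter_Ico _ (by omega : pos σ v ≤ N + 1)]
  congr 1
  refine card_bij' (fun x _ => x.2) (fun i _ => (pos σ v, i)) ?_ ?_ ?_ ?_
  all_goals grind [ressPairs, padded]

lemma upCross_add_resAt (hv : v ∈ Icc 1 N) :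
    upCross (entry σ) v (pos σ v) + resAt σ v = upCross (entry σ) v (N + 1) := by
  have hp := mem_Icc.1 (pos_mem_Icc σ hv)
  have hpos := fun i => entry_eq_iff (σ := σ) (i := i) hv
  have hlast := entry_eq_zero_of_notMem σ (i := N + 1) (by simp)
  rw [upCross, upCross, ← count_add_card_filter_Ico _ (by omega : pos σ v ≤ N + 1)]
  congr 1
  refine card_bij' (fun x _ => x.2) (fun i _ => (pos σ v, i)) ?_ ?_ ?_ ?_
  all_goals grind [resPairs]

/-- The right embracing number of a value: `res` for closed words, `ress` for open ones. -/
def rightAt (c : Bool) (σ : Equiv.Perm (Fin N)) (v : ℕ) : ℕ :=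
  bif c then resAt σ v else ressAt σ v

/-- The number of possible left embracing numbers of a value of shape `x` inserted at height `h`. -/
def places (c : Bool) (x : Shape) (h : ℕ) : ℕ := if x.isTop then h else h + 1 - c.toNat

lemma lesAt_add_rightAt_add_one (hv : v ∈ Icc 1 N) :
    lesAt σ v + rightAt c σ v + 1 = places c (shape c σ v) (height c σ v) := by
  have hp := mem_Icc.1 (pos_mem_Icc σ hv)
  have hw := fun i => padded_eq_iff (c := c) (σ := σ) (i := i) hv
  rw [lesAt_eq_strictDownCross c hv]
  cases c with
  | false =>
    have hright := strictDownCross_add_ressAt (σ := σ) hv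
    have hheight := downCross_eq_strictDownCross_add hw (N + 1)
    simp only [rightAt, cond_false, hright, places, height, hheight, isTop_shape_eq_true]
    grind
  | true =>
    rw [padded_true] at hw
    have hright := upCross_add_resAt (σ := σ) hv
    have hdown := downCross_eq_strictDownCross_of_le hw le_rfl
    have hpos := downCross_add_eq_upCross_add (entry σ) v (pos σ v)
    have hlast := downCross_add_eq_upCross_add (entry σ) v (N + 1)
    simp only [rightAt, cond_true, places, height, padded_true]
    grind [entry_eq_zero_of_notMem σ (i := 0), entry_eq_zero_of_notMem σ (i := N + 1), entry_pos]

/-! ### A permutation is determined by its steps -/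

/-- How the insertion of a value by the step `s` moves the number `d` of crossings to the left of
an earlier value. -/
def insertLevel (s : Step) (d : ℕ) : ℕ := if s.2 < d then next d s.1 else d

lemma pos_lt_pos_iff (hu : u ∈ Icc 1 N) (hv : v ∈ Icc 1 N) (huv : u < v) :
    pos σ v < pos σ u ↔ (step c σ v).2 < downCross (padded c σ) v (pos σ u) := by
  rw [step, lesAt_eq_strictDownCross c hv]
  exact lt_iff_strictDownCross_lt_downCross (fun i => padded_eq_iff hv) (by rwa [padded_pos hu])

lemma downCross_succ_pos_of_lt (hu : u ∈ Icc 1 N) (hv : v ∈ Icc 1 N) (huv : u < v) :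
    downCross (padded c σ) (v + 1) (pos σ u) =
      insertLevel (step c σ v) (downCross (padded c σ) v (pos σ u)) := by
  have hw := fun i => padded_eq_iff (c := c) (σ := σ) (i := i) hv
  have hdown := downCross_eq_strictDownCross_add hw (pos σ u)
  have hup := downCross_succ_eq_strictDownCross_add hw (mem_Icc.1 (pos_mem_Icc σ hv)).1 (pos σ u)
  have hpos := (pos_inj (σ := σ) hv hu).not.2 huv.ne'
  rw [insertLevel, if_congr (pos_lt_pos_iff hu hv huv).symm rfl rfl]
  simp only [next, step, shape, Bool.toNat, Bool.cond_decide]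
  grind

lemma downCross_succ_pos_self (hv : v ∈ Icc 1 N) :
    downCross (padded c σ) (v + 1) (pos σ v) = (step c σ v).2 + (step c σ v).1.isBot.toNat := by
  rw [downCross_succ_eq_strictDownCross_add (fun i => padded_eq_iff hv)
    (mem_Icc.1 (pos_mem_Icc σ hv)).1, step, lesAt_eq_strictDownCross c hv]
  simp [shape, Bool.toNat, Bool.cond_decide]

lemma downCross_pos_congr (hstep : ∀ v ∈ Icc 1 N, step c σ v = step c τ v) (hu : u ∈ Icc 1 N)
    (huv : u < v) (hv : v ≤ N + 1) :
    downCross (padded c σ) v (pos σ u) = downCross (padded c τ) v (pos τ u) := by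
  induction v, huv using Nat.le_induction with
  | base => rw [downCross_succ_pos_self hu, downCross_succ_pos_self hu, hstep u hu]
  | succ v huv ih =>
    have hvN : v ∈ Icc 1 N := by grind
    rw [downCross_succ_pos_of_lt hu hvN huv, downCross_succ_pos_of_lt hu hvN huv, hstep v hvN,
      ih (by omega)]

lemma pos_lt_pos_congr (hstep : ∀ v ∈ Icc 1 N, step c σ v = step c τ v) (hu : u ∈ Icc 1 N)
    (hv : v ∈ Icc 1 N) : pos σ u < pos σ v ↔ pos τ u < pos τ v := by
  have hlt {u v : ℕ} (hu : u ∈ Icc 1 N) (hv : v ∈ Icc 1 N) (huv : u < v) :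
      pos σ v < pos σ u ↔ pos τ v < pos τ u := by
    rw [pos_lt_pos_iff (c := c) hu hv huv, pos_lt_pos_iff (c := c) hu hv huv, hstep v hv,
      downCross_pos_congr hstep hu huv (by grind)]
  have hσ := pos_inj (σ := σ) hu hv
  have hτ := pos_inj (σ := τ) hu hv
  rcases lt_trichotomy u v with huv | rfl | huv
  · have := hlt hu hv huv
    omega
  · simp
  · exact hlt hv hu huv

lemma eq_of_pos_lt_pos_iff
    (h : ∀ u ∈ Icc 1 N, ∀ v ∈ Icc 1 N, pos σ u < pos σ v ↔ pos τ u < pos τ v) : σ = τ := by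
  have hmono : StrictMono (σ.trans τ.symm) := fun i j hij => by
    have := h (σ i + 1) (by grind) (σ j + 1) (by grind)
    simpa [pos, entry_eq_apply_add_one, hij] using this
  have hrefl : hmono.orderIsoOfSurjective _ (σ.trans τ.symm).surjective = OrderIso.refl _ :=
    Subsingleton.elim _ _
  ext1 i
  exact (Equiv.symm_apply_eq τ).1 (DFunLike.congr_fun hrefl i)

lemma eq_of_step_eq (hstep : ∀ v ∈ Icc 1 N, step c σ v = step c τ v) : σ = τ :=
  eq_of_pos_lt_pos_iff fun _ hu _ hv => pos_lt_pos_congr hstep hu hv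

/-! ### Laguerre histories -/

/-- The steps available at height `h`. -/
def steps (c : Bool) (h : ℕ) : Finset Step := univ.sigma fun x => range (places c x h)

/-- The Laguerre histories with `r` steps leading from height `h` to height `0`. -/
def histories (c : Bool) : ℕ → ℕ → Finset (List Step)
  | 0, h => if h = 0 then {[]} else ∅
  | r + 1, h => ((steps c h).sigma fun s => histories c r (next h s.1)).image fun y => y.1 :: y.2

lemma mem_steps {h : ℕ} {s : Step} : s ∈ steps c h ↔ s.2 < places c s.1 h := by
  simp [steps]

lemma cons_mem_histories {r h : ℕ} {s : Step} {l : List Step} :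
    s :: l ∈ histories c (r + 1) h ↔ s.2 < places c s.1 h ∧ l ∈ histories c r (next h s.1) := by
  simp [histories, mem_steps]

lemma sum_steps {M : Type*} [AddCommMonoid M] (c : Bool) (h : ℕ) (f : Step → M) :
    ∑ s ∈ steps c h, f s = ∑ x, ∑ i ∈ range (places c x h), f ⟨x, i⟩ :=
  sum_sigma ..

lemma sum_histories_succ {M : Type*} [AddCommMonoid M] (c : Bool) (r h : ℕ) (f : List Step → M) :
    ∑ l ∈ histories c (r + 1) h, f l =
      ∑ s ∈ steps c h, ∑ l ∈ histories c r (next h s.1), f (s :: l) := by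
  rw [histories, sum_image, sum_sigma]
  rintro ⟨s, l⟩ - ⟨s', l'⟩ - hcons
  simpa using hcons

lemma card_histories_succ (c : Bool) (r h : ℕ) : #(histories c (r + 1) h) =
    (h + 1 - c.toNat) * (#(histories c r (h + 1)) + #(histories c r h)) +
      h * (#(histories c r h) + #(histories c r (h - 1))) := by
  simp only [card_eq_sum_ones, sum_histories_succ, sum_steps]
  simp only [Shape.sum_univ, places, next, Shape.valley_isTop, Shape.valley_isBot,
    Shape.doubleAscent_isTop, Shape.doubleAscent_isBot, Shape.peak_isTop, Shape.peak_isBot,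
    Shape.doubleDescent_isTop, Shape.doubleDescent_isBot, Bool.false_eq_true, ↓reduceIte,
    Bool.toNat_true, Bool.toNat_false, sum_const, smul_eq_mul, mul_one, card_range, tsub_zero,
    add_zero, add_tsub_cancel_right]
  ring

lemma card_histories_zero (c : Bool) (h : ℕ) : #(histories c 0 h) = if h = 0 then 1 else 0 := by
  rw [histories]
  split_ifs <;> simp

lemma card_histories_false (r h : ℕ) : #(histories false r h) = r.factorial * r.choose h := by
  induction r generalizing h with
  | zero => cases h <;> simp [card_histories_zero]
  | succ r ih =>
    have hup := Nat.add_one_mul_choose_eq r h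
    rw [card_histories_succ, ih, ih, ih, Nat.factorial_succ]
    cases h with
    | zero =>
      simp only [Bool.toNat_false, Nat.choose_zero_right]
      grind
    | succ h =>
      have hdown := Nat.add_one_mul_choose_eq r h
      simp only [Nat.choose_succ_succ, Bool.toNat_false, Nat.sub_zero, Nat.add_sub_cancel] at *
      grind

lemma card_histories_true_zero (r : ℕ) : #(histories true (r + 1) 0) = 0 := by
  simp [card_histories_succ]

lemma card_histories_true (r h : ℕ) :
    #(histories true (r + 1) (h + 1)) = (r + 1).factorial * r.choose h := by
  induction r generalizing h with
  | zero => cases h <;> simp [card_histories_succ, card_histories_zero]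
  | succ r ih =>
    have hpascal := Nat.add_one_mul_choose_eq (r + 1) h
    rw [card_histories_succ, ih, ih, Nat.factorial_succ (r + 1)]
    cases h with
    | zero =>
      simp only [zero_add, Nat.sub_self, Nat.choose_zero_right, Nat.choose_one_right,
        card_histories_true_zero]
      grind
    | succ h =>
      rw [Nat.add_sub_cancel, ih, Bool.toNat_true]
      simp only [Nat.choose_succ_succ, Nat.add_sub_cancel] at *
      grind

/-- The Laguerre history of a permutation: the word of its steps. -/
def history (c : Bool) (σ : Equiv.Perm (Fin N)) : List Step := (List.range' 1 N).map (step c σ)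

lemma history_injective (c : Bool) : Function.Injective (history c (N := N)) := fun σ τ h =>
  eq_of_step_eq fun v hv => List.map_inj_left.1 h v (by grind)

lemma map_step_mem_histories (σ : Equiv.Perm (Fin N)) {r : ℕ} (hv : 1 ≤ v) (hr : v + r = N + 1) :
    (List.range' v r).map (step c σ) ∈ histories c r (height c σ v) := by
  induction r generalizing v with
  | zero => simp [histories, show v = N + 1 from hr, height_last]
  | succ r ih =>
    have hvN : v ∈ Icc 1 N := by grind
    rw [List.range'_succ, List.map_cons, cons_mem_histories]
    refine ⟨?_, ?_⟩
    · have := lesAt_add_rightAt_add_one (c := c) (σ := σ) hvN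
      simp only [step]
      omega
    · simp only [step, ← height_succ hvN]
      exact ih (by omega) (by omega)

lemma history_mem_histories (hN : c.toNat ≤ N) (σ : Equiv.Perm (Fin N)) :
    history c σ ∈ histories c N c.toNat :=
  height_one (σ := σ) hN ▸ map_step_mem_histories σ le_rfl (Nat.add_comm ..)

lemma card_histories (hN : c.toNat ≤ N) : #(histories c N c.toNat) = N.factorial := by
  cases c with
  | false => simp [card_histories_false]
  | true =>
    obtain ⟨N, rfl⟩ := Nat.exists_eq_add_of_le' hN
    simp [card_histories_true]

lemma image_history (hN : c.toNat ≤ N) :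
    univ.image (history c (N := N)) = histories c N c.toNat := by
  refine eq_of_subset_of_card_le (by grind [history_mem_histories]) ?_
  rw [card_image_of_injective _ (history_injective c), card_histories hN, card_univ,
    Fintype.card_perm, Fintype.card_fin]

lemma sum_history {M : Type*} [AddCommMonoid M] (hN : c.toNat ≤ N) (f : List Step → M) :
    ∑ σ : Equiv.Perm (Fin N), f (history c σ) = ∑ l ∈ histories c N c.toNat, f l := by
  rw [← image_history hN, sum_image (history_injective c).injOn]

/-! ### Statistics as sums over values -/

lemma sum_entry {M : Type*} [AddCommMonoid M] (σ : Equiv.Perm (Fin N)) (f : ℕ → M) :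
    ∑ i ∈ Icc 1 N, f (entry σ i) = ∑ v ∈ Icc 1 N, f v :=
  sum_bij' (fun i _ => entry σ i) (fun v _ => pos σ v) (fun _ => entry_mem_Icc σ)
    (fun _ => pos_mem_Icc σ) (fun _ => pos_entry σ) (fun _ => entry_pos σ) fun _ _ => rfl

lemma les_eq_sum_lesAt (σ : Equiv.Perm (Fin N)) : les σ = ∑ v ∈ Icc 1 N, lesAt σ v :=
  card_eq_sum_card_fiberwise fun x hx => by
    simp only [lesPairs, coe_filter, Set.mem_ofPred_eq, mem_product] at hx
    exact entry_mem_Icc σ hx.1.2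

lemma ress_eq_sum_ressAt (σ : Equiv.Perm (Fin N)) : ress σ = ∑ v ∈ Icc 1 N, ressAt σ v :=
  card_eq_sum_card_fiberwise fun x hx => by
    simp only [ressPairs, coe_filter, Set.mem_ofPred_eq, mem_product] at hx
    exact entry_mem_Icc σ hx.1.1

lemma res_eq_sum_resAt (σ : Equiv.Perm (Fin N)) : res σ = ∑ v ∈ Icc 1 N, resAt σ v :=
  card_eq_sum_card_fiberwise fun x hx => by
    simp only [resPairs, coe_filter, Set.mem_ofPred_eq, mem_product] at hx
    exact entry_mem_Icc σ hx.1.1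

lemma sum_rightAt (c : Bool) (σ : Equiv.Perm (Fin N)) :
    ∑ v ∈ Icc 1 N, rightAt c σ v = bif c then res σ else ress σ := by
  cases c
  · exact (ress_eq_sum_ressAt σ).symm
  · exact (res_eq_sum_resAt σ).symm

lemma isLRMaxAt_pos_iff (c : Bool) (hv : v ∈ Icc 1 N) :
    IsLRMaxAt σ (pos σ v) ↔ (shape c σ v).isBot = false ∧ lesAt σ v = 0 := by
  have hforall := forall_lt_iff_strictDownCross_eq_zero fun i =>
    padded_eq_iff (c := c) (σ := σ) (i := i) hv
  have hp := pos_mem_Icc σ hv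
  have h0 := entry_eq_zero_of_notMem σ (i := 0) (by simp)
  rw [← Bool.not_eq_true, isBot_shape_eq_true, lesAt_eq_strictDownCross c hv, ← hforall]
  grind [IsLRMaxAt, padded, entry_pos]

lemma lema_eq_sum (c : Bool) (σ : Equiv.Perm (Fin N)) :
    lema σ = ∑ v ∈ Icc 1 N,
      if Even v ∧ (shape c σ v).isBot = false ∧ lesAt σ v = 0 then 1 else 0 := by
  rw [lema, card_filter]
  refine Eq.trans ?_ (sum_entry σ _)
  refine sum_congr rfl fun i hi => if_congr ?_ rfl rfl
  rw [← isLRMaxAt_pos_iff c (entry_mem_Icc σ hi), pos_entry σ hi, and_comm]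

lemma isDescentBottom_iff (c : Bool) (hv : v ∈ Icc 1 N) :
    IsDescentBottom σ v ↔ (shape c σ v).isBot = true := by
  have hp := pos_mem_Icc σ hv
  have hpos := fun i => entry_eq_iff (σ := σ) (i := i) hv
  have h0 := entry_eq_zero_of_notMem σ (i := 0) (by simp)
  rw [isBot_shape_eq_true, padded_of_le (by grind)]
  constructor
  · rintro ⟨i, _, _, _⟩
    grind
  · exact fun h => ⟨pos σ v - 1, by grind⟩

lemma isDescentTop_iff (hv : v ∈ Icc 1 N) :
    IsDescentTop σ v ↔ (shape false σ v).isTop = true := by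
  have hp := pos_mem_Icc σ hv
  have hpos := fun i => entry_eq_iff (σ := σ) (i := i) hv
  rw [isTop_shape_eq_true]
  constructor
  · rintro ⟨i, _, _, _⟩
    grind [padded]
  · exact fun h => ⟨pos σ v, by grind [padded]⟩

lemma des_eq_sum (c : Bool) (σ : Equiv.Perm (Fin N)) :
    des σ = ∑ v ∈ Icc 1 N, (shape c σ v).isBot.toNat := by
  simp only [shape, Bool.toNat, Bool.cond_decide, ← card_filter]
  refine card_bij' (fun i _ => entry σ (i + 1)) (fun v _ => pos σ v - 1) ?_ ?_ ?_ ?_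
  all_goals
    grind [entry_eq_zero_of_notMem, padded, pos_entry, entry_pos, pos_mem_Icc, entry_mem_Icc]

/-- The right embracing number of a value inserted by the step `s` at height `h`. -/
def stepRight (c : Bool) (h : ℕ) (s : Step) : ℕ := places c s.1 h - 1 - s.2

lemma rightAt_eq_stepRight (hv : v ∈ Icc 1 N) :
    rightAt c σ v = stepRight c (height c σ v) (step c σ v) := by
  have := lesAt_add_rightAt_add_one (c := c) (σ := σ) hv
  simp only [stepRight, step]
  omega

/-! ### Transfer sums -/

section Transfer

variable {R : Type*} [CommSemiring R]

/-- The contribution of the step `s` at height `h` to the weight of a permutation. The weight `a` of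
a left-to-right maximum may depend on the parity of the inserted value. -/
def stepWeight (c : Bool) (a p q t : R) (h : ℕ) (s : Step) : R :=
  (if s.1.isBot = false ∧ s.2 = 0 then a else 1) * p ^ stepRight c h s * q ^ s.2 *
    t ^ s.1.isBot.toNat

lemma weight_eq_prod_stepWeight (c : Bool) (a p q t : R) (σ : Equiv.Perm (Fin N)) :
    a ^ lema σ * p ^ (bif c then res σ else ress σ) * q ^ les σ * t ^ des σ =
      ∏ v ∈ Icc 1 N, stepWeight c (if Even v then a else 1) p q t (height c σ v) (step c σ v) := by
  rw [lema_eq_sum c, ← sum_rightAt, les_eq_sum_lesAt, des_eq_sum c]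
  simp only [← prod_pow_eq_pow_sum, ← prod_mul_distrib]
  refine prod_congr rfl fun v hv => ?_
  rw [stepWeight, ← rightAt_eq_stepRight hv]
  by_cases hE : Even v <;> simp [hE, step, pow_ite]

lemma stepWeight_last (hN : 1 ≤ N) (p q t : R) (σ : Equiv.Perm (Fin N)) :
    stepWeight true 1 p q t (height true σ N) (step true σ N) = 1 := by
  have hNN : N ∈ Icc 1 N := by grind
  have hright := rightAt_eq_stepRight (c := true) (σ := σ) hNN
  have hplaces := lesAt_add_rightAt_add_one (c := true) (σ := σ) hNN
  have hheight := height_succ_add (c := true) (σ := σ) hNN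
  have htop := Bool.toNat_le (shape true σ N).isTop
  rw [height_last] at hheight
  simp only [places, Bool.toNat_true, Nat.add_sub_cancel, ite_self] at hplaces
  have hles : lesAt σ N = 0 := by omega
  have hright₀ : rightAt true σ N = 0 := by omega
  rw [stepWeight, ← hright, hright₀]
  simp [step, hles, isBot_shape_last]

lemma prod_Icc_one_eq_prod_pairs {n : ℕ} (hN : N = 2 * n + c.toNat) (f : ℕ → R) :
    ∏ v ∈ Icc 1 N, f v =
      (∏ j ∈ range n, f (1 + 2 * j) * f (1 + 2 * j + 1)) * bif c then f N else 1 := by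
  have heven : ∏ v ∈ Icc 1 (2 * n), f v = ∏ j ∈ range n, f (1 + 2 * j) * f (1 + 2 * j + 1) := by
    clear hN
    induction n with
    | zero => simp
    | succ n ih =>
      rw [prod_range_succ, ← ih, show 2 * (n + 1) = 2 * n + 1 + 1 by ring,
        prod_Icc_succ_top (by omega), prod_Icc_succ_top (by omega)]
      ring_nf
  subst hN
  cases c
  · simp [heven]
  · simp [prod_Icc_succ_top, heven]

lemma weight_eq_prod_pairs {n : ℕ} (hN : N = 2 * n + c.toNat) (a p q t : R)
    (σ : Equiv.Perm (Fin N)) :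
    a ^ lema σ * p ^ (bif c then res σ else ress σ) * q ^ les σ * t ^ des σ =
      ∏ j ∈ range n, stepWeight c 1 p q t (height c σ (1 + 2 * j)) (step c σ (1 + 2 * j)) *
        stepWeight c a p q t (height c σ (1 + 2 * j + 1)) (step c σ (1 + 2 * j + 1)) := by
  have hodd (j : ℕ) : ¬ Even (1 + 2 * j) := by grind
  have heven (j : ℕ) : Even (1 + 2 * j + 1) := by grind
  rw [weight_eq_prod_stepWeight c, prod_Icc_one_eq_prod_pairs hN]
  simp only [if_neg (hodd _), if_pos (heven _)]
  cases c
  · simp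
  · rw [Bool.toNat_true] at hN
    have hlast : ¬ Even N := by grind
    simp [hlast, stepWeight_last (by omega : 1 ≤ N)]

/-- The product of the weights `Ω h s s'` of the pairs of consecutive steps at odd and even
positions of a history that starts at height `h`. -/
def pairProd (Ω : ℕ → Step → Step → R) : ℕ → List Step → R
  | h, s :: s' :: l => Ω h s s' * pairProd Ω (next (next h s.1) s'.1) l
  | _, _ => 1

lemma pairProd_map_step (Ω : ℕ → Step → Step → R) (σ : Equiv.Perm (Fin N)) (n : ℕ) (hv : 1 ≤ v)
    (hN : v + (2 * n + c.toNat) = N + 1) :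
    pairProd Ω (height c σ v) ((List.range' v (2 * n + c.toNat)).map (step c σ)) =
      ∏ j ∈ range n,
        Ω (height c σ (v + 2 * j)) (step c σ (v + 2 * j)) (step c σ (v + 2 * j + 1)) := by
  induction n generalizing v with
  | zero => cases c <;> simp [pairProd]
  | succ n ih =>
    have hlen : 2 * (n + 1) + c.toNat = 2 * n + c.toNat + 1 + 1 := by ring
    rw [hlen, List.range'_succ, List.range'_succ, List.map_cons, List.map_cons, pairProd,
      prod_range_succ', mul_comm]
    have hnext : next (next (height c σ v) (step c σ v).1) (step c σ (v + 1)).1 =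
        height c σ (v + 1 + 1) := by
      rw [height_succ (v := v + 1) (by grind), height_succ (v := v) (by grind)]
      rfl
    rw [hnext, ih (by omega) (by omega)]
    congr 1
    refine prod_congr rfl fun j _ => ?_
    rw [show v + 1 + 1 + 2 * j = v + 2 * (j + 1) by ring]

/-- The sum over the histories from height `h` with `2 * n` steps, and a further one in the closed
case, of the products of the weights of the pairs of consecutive steps. -/
def transferSum (c : Bool) (Ω : ℕ → Step → Step → R) (n h : ℕ) : R :=
  ∑ l ∈ histories c (2 * n + c.toNat) h, pairProd Ω h l

/-- The weight of two consecutive steps, the second one inserting an even value, which vanishes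
unless the condition `A` holds. -/
def pairWeight (c : Bool) (A : ℕ → Step → Step → Prop) [∀ h s s', Decidable (A h s s')]
    (a p q t : R) (h : ℕ) (s s' : Step) : R :=
  if A h s s' then stepWeight c 1 p q t h s * stepWeight c a p q t (next h s.1) s' else 0

lemma sum_filter_weight_eq_transferSum {n : ℕ} (hN : N = 2 * n + c.toNat)
    (P : Equiv.Perm (Fin N) → Prop) [DecidablePred P]
    (A : ℕ → Step → Step → Prop) [∀ h s s', Decidable (A h s s')]
    (hP : ∀ σ, P σ ↔ ∀ j ∈ range n, A (height c σ (1 + 2 * j)) (step c σ (1 + 2 * j))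
      (step c σ (1 + 2 * j + 1))) (a p q t : R) :
    ∑ σ with P σ, a ^ lema σ * p ^ (bif c then res σ else ress σ) * q ^ les σ * t ^ des σ =
      transferSum c (pairWeight c A a p q t) n c.toNat := by
  have hcN : c.toNat ≤ N := by omega
  rw [transferSum, ← hN, ← sum_history hcN, sum_filter]
  refine sum_congr rfl fun σ _ => ?_
  have hprod := pairProd_map_step (c := c) (pairWeight c A a p q t) σ n le_rfl (by omega)
  rw [height_one hcN, ← hN] at hprod
  rw [history, hprod]
  simp only [pairWeight]
  rw [prod_ite_zero]
  refine if_congr (hP σ) ?_ rfl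
  rw [weight_eq_prod_pairs hN]
  refine prod_congr rfl fun j hj => ?_
  rw [height_succ (by grind)]
  rfl

end Transfer

/-! ### Motzkin paths -/

section Motzkin

variable {R : Type*} [CommSemiring R]

/-- The weighted sum over the Motzkin paths with `n` steps from height `h` to height `0`, where a
step from height `i` to `i + 1`, `i` to `i`, `i + 1` to `i` has weight `u i`, `b i`, `d i`. -/
def motzkinSum (u b d : ℕ → R) : ℕ → ℕ → R
  | 0, h => if h = 0 then 1 else 0
  | n + 1, 0 => u 0 * motzkinSum u b d n 1 + b 0 * motzkinSum u b d n 0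
  | n + 1, h + 1 => u (h + 1) * motzkinSum u b d n (h + 2) +
      b (h + 1) * motzkinSum u b d n (h + 1) + d h * motzkinSum u b d n h

lemma motzkinSum_eq_prod_mul (u b d : ℕ → R) (n h : ℕ) :
    motzkinSum u b d n h =
      (∏ i ∈ range h, d i) * motzkinSum (fun i => u i * d i) b (fun _ => 1) n h := by
  induction n generalizing h with
  | zero => cases h <;> simp [motzkinSum]
  | succ n ih =>
    cases h <;> simp only [motzkinSum, ih, prod_range_succ, prod_range_zero] <;> ring

lemma motzkinSum_congr {u u' b b' d d' : ℕ → R} (hb : ∀ h, b h = b' h)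
    (hud : ∀ h, u h * d h = u' h * d' h) (n : ℕ) :
    motzkinSum u b d n 0 = motzkinSum u' b' d' n 0 := by
  rw [motzkinSum_eq_prod_mul, motzkinSum_eq_prod_mul u', funext hb, funext hud, prod_range_zero,
    prod_range_zero]

/-- The sum of the weights of the pairs of consecutive steps of shapes `x` and `y` that start at
height `h`. -/
def pairCoeff (c : Bool) (Ω : ℕ → Step → Step → R) (h : ℕ) (x y : Shape) : R :=
  ∑ i ∈ range (places c x h), ∑ j ∈ range (places c y (next h x)), Ω h ⟨x, i⟩ ⟨y, j⟩

lemma pairCoeff_eq_zero {Ω : ℕ → Step → Step → R} {h : ℕ} {x y : Shape} (c : Bool)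
    (hΩ : ∀ i j, Ω h ⟨x, i⟩ ⟨y, j⟩ = 0) : pairCoeff c Ω h x y = 0 :=
  sum_eq_zero fun i _ => sum_eq_zero fun j _ => hΩ i j

lemma transferSum_zero (c : Bool) (Ω : ℕ → Step → Step → R) (h : ℕ) :
    transferSum c Ω 0 (h + c.toNat) = if h = 0 then 1 else 0 := by
  cases c with
  | false =>
    cases h <;> simp [transferSum, histories, pairProd]
  | true =>
    have hlast (x : Shape) (i : ℕ) : ∑ l ∈ histories true 0 (next (h + 1) x),
        pairProd Ω (h + 1) (⟨x, i⟩ :: l) = if next (h + 1) x = 0 then 1 else 0 := by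
      rw [histories]
      split_ifs <;> simp [pairProd]
    rw [transferSum, Nat.mul_zero, Nat.zero_add, Bool.toNat_true, sum_histories_succ, sum_steps]
    simp only [hlast]
    cases h <;> simp [Shape.sum_univ, places, next, -sum_boole]

lemma transferSum_succ (c : Bool) (Ω : ℕ → Step → Step → R) (n h : ℕ) :
    transferSum c Ω (n + 1) h =
      ∑ x, ∑ y, pairCoeff c Ω h x y * transferSum c Ω n (next (next h x) y) := by
  rw [transferSum, show 2 * (n + 1) + c.toNat = 2 * n + c.toNat + 1 + 1 by ring]
  simp only [sum_histories_succ, sum_steps, pairProd, ← mul_sum]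
  refine sum_congr rfl fun x _ => ?_
  rw [sum_comm]
  refine sum_congr rfl fun y _ => ?_
  simp only [pairCoeff, sum_mul]
  rfl

open Shape

/-- The possible shapes of the values `2 * j - 1` and `2 * j` of an `E`-permutation. -/
def IsEPair (x y : Shape) : Prop :=
  x.isTop = false ∧ y.isBot = false ∧ ¬ (x.isBot = true ∧ y.isTop = true)
deriving Decidable

/-- The possible shapes of the values `2 * j - 1` and `2 * j` of an `F`-permutation. -/
def IsFPair (x y : Shape) : Prop := x ≠ doubleDescent ∧ y = doubleAscent
deriving Decidable

lemma transferSum_false_eq_motzkinSum {Ω : ℕ → Step → Step → R}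
    (hΩ : ∀ h s s', Ω h s s' ≠ 0 → IsEPair s.1 s'.1) (n h : ℕ) :
    transferSum false Ω n h =
      motzkinSum (fun h => pairCoeff false Ω h valley doubleAscent)
        (fun h => pairCoeff false Ω h doubleAscent doubleAscent)
        (fun h => pairCoeff false Ω (h + 1) doubleAscent peak) n h := by
  have hcoeff {x y : Shape} (hxy : ¬ IsEPair x y) (h : ℕ) : pairCoeff false Ω h x y = 0 :=
    pairCoeff_eq_zero _ fun i j => not_imp_comm.1 (hΩ h ⟨x, i⟩ ⟨y, j⟩) hxy
  induction n generalizing h with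
  | zero => exact transferSum_zero false Ω h
  | succ n ih =>
    rw [transferSum_succ]
    cases h with
    | zero =>
      have hdown : pairCoeff false Ω 0 doubleAscent peak = 0 := by
        simp [pairCoeff, places, next]
      simp [Shape.sum_univ, hcoeff, IsEPair, hdown, motzkinSum, ih, next]
    | succ h =>
      simp [Shape.sum_univ, hcoeff, IsEPair, motzkinSum, ih, next, add_assoc]

lemma transferSum_true_eq_motzkinSum {Ω : ℕ → Step → Step → R}
    (hΩ : ∀ h s s', Ω h s s' ≠ 0 → IsFPair s.1 s'.1) (n h : ℕ) :
    transferSum true Ω n (h + 1) =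
      motzkinSum (fun h => pairCoeff true Ω (h + 1) valley doubleAscent)
        (fun h => pairCoeff true Ω (h + 1) doubleAscent doubleAscent)
        (fun h => pairCoeff true Ω (h + 2) peak doubleAscent) n h := by
  have hcoeff {x y : Shape} (hxy : ¬ IsFPair x y) (h : ℕ) : pairCoeff true Ω h x y = 0 :=
    pairCoeff_eq_zero _ fun i j => not_imp_comm.1 (hΩ h ⟨x, i⟩ ⟨y, j⟩) hxy
  induction n generalizing h with
  | zero => exact transferSum_zero true Ω h
  | succ n ih =>
    rw [transferSum_succ]
    cases h with
    | zero =>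
      have hdown : pairCoeff true Ω 1 peak doubleAscent = 0 := by
        simp [pairCoeff, places, next]
      simp [Shape.sum_univ, Shape.ext_iff, hcoeff, IsFPair, hdown, motzkinSum, ih, next]
    | succ h =>
      simp [Shape.sum_univ, Shape.ext_iff, hcoeff, IsFPair, motzkinSum, ih, next, add_assoc]

end Motzkin

/-! ### `E`- and `F`-permutations in terms of steps -/

lemma forall_mem_Icc_one_iff {P : ℕ → Prop} {n : ℕ} :
    (∀ j ∈ Icc 1 n, P j) ↔ ∀ j ∈ range n, P (j + 1) := by
  refine ⟨fun h j hj => h (j + 1) (by grind), fun h j hj => ?_⟩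
  obtain ⟨j, rfl⟩ := Nat.exists_eq_add_of_le' (mem_Icc.1 hj).1
  exact h j (by grind)

lemma forall_mem_Icc_one_two_mul_iff {P : ℕ → Prop} {n : ℕ} :
    (∀ v ∈ Icc 1 (2 * n), P v) ↔ ∀ j ∈ range n, P (1 + 2 * j) ∧ P (1 + 2 * j + 1) := by
  refine ⟨fun h j hj => ⟨h _ (by grind), h _ (by grind)⟩, fun h v hv => ?_⟩
  rcases Nat.even_or_odd' v with ⟨j, rfl | rfl⟩
  · have := (h (j - 1) (by grind)).2
    grind
  · have := (h j (by grind)).1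
    grind

lemma height_add_card_isTop (hc : c.toNat ≤ N) (hv : v ∈ Icc 1 (N + 1)) :
    height c σ v + #{u ∈ Ico 1 v | (shape c σ u).isTop = true} =
      c.toNat + #{u ∈ Ico 1 v | (shape c σ u).isBot = true} := by
  obtain ⟨hv₁, hvN⟩ := mem_Icc.1 hv
  clear hv
  induction v, hv₁ using Nat.le_induction with
  | base => simp [height_one hc]
  | succ v hv₁ ih =>
    have hsucc := height_succ_add (c := c) (σ := σ) (v := v) (by grind)
    have := ih (by omega)
    simp only [card_filter, sum_Ico_succ_top hv₁] at *
    grind [Bool.toNat]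

lemma isEvenOddDescent_iff : IsEvenOddDescent σ ↔ ∀ v ∈ Icc 1 N,
    ((shape false σ v).isTop = true → Even v) ∧ ((shape false σ v).isBot = true → Odd v) := by
  have h : IsEvenOddDescent σ ↔ ∀ v ∈ Icc 1 N,
      (IsDescentTop σ v → Even v) ∧ (IsDescentBottom σ v → Odd v) := by
    unfold IsEvenOddDescent IsDescentTop IsDescentBottom
    grind [entry_mem_Icc]
  rw [h]
  exact forall₂_congr fun v hv => by rw [isDescentTop_iff hv, isDescentBottom_iff false hv]

lemma isEPerm_iff {n : ℕ} (σ : Equiv.Perm (Fin (2 * n))) : IsEPerm n σ ↔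
    ∀ j ∈ range n, IsEPair (shape false σ (1 + 2 * j)) (shape false σ (1 + 2 * j + 1)) := by
  rw [IsEPerm, isEvenOddDescent_iff, forall_mem_Icc_one_two_mul_iff, forall_mem_Icc_one_iff,
    ← forall₂_and]
  refine forall₂_congr fun j hj => ?_
  rw [show 2 * (j + 1) - 1 = 1 + 2 * j by omega, show 2 * (j + 1) = 1 + 2 * j + 1 by ring,
    isDescentBottom_iff false (by grind), isDescentTop_iff (by grind)]
  grind [IsEPair]

lemma mem_signature_iff (hv : v ∈ Icc 1 N) : v ∈ signature σ ↔
    (shape false σ v).isTop = true ∨ (shape false σ v).isBot = true := by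
  rw [signature, mem_filter, isDescentTop_iff hv, isDescentBottom_iff false hv, and_iff_right hv]

lemma sig_eq_height_add (hσ : IsEvenOddDescent σ) (hv : v ∈ Icc 1 N) :
    sig σ v = height false σ v + if v ∈ signature σ ∧ Even v then 0 else 1 := by
  have hshape := isEvenOddDescent_iff.1 hσ
  have hheight := height_add_card_isTop (c := false) (σ := σ) (v := v) (by simp) (by grind)
  have hodd : (signature σ).filter (fun u => Odd u ∧ u < v) =
      {u ∈ Ico 1 v | (shape false σ u).isBot = true} := by
    ext u
    have := fun hu => mem_signature_iff (σ := σ) (v := u) hu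
    grind [signature]
  have heven : (signature σ).filter (fun u => Even u ∧ u < v) =
      {u ∈ Ico 1 v | (shape false σ u).isTop = true} := by
    ext u
    have := fun hu => mem_signature_iff (σ := σ) (v := u) hu
    grind [signature]
  rw [sig, hodd, heven]
  simp only [Bool.toNat_false] at hheight
  grind

lemma sig_eq_of_odd (hσ : IsEvenOddDescent σ) (hv : v ∈ Icc 1 N) (hodd : Odd v) :
    sig σ v = height false σ v + 1 := by
  rw [sig_eq_height_add hσ hv, if_neg (by grind)]

lemma sig_eq_of_isTop (hσ : IsEvenOddDescent σ) (hv : v ∈ Icc 1 N)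
    (htop : (shape false σ v).isTop = true) : sig σ v = height false σ v := by
  have heven := (isEvenOddDescent_iff.1 hσ v hv).1 htop
  rw [sig_eq_height_add hσ hv, if_pos ⟨(mem_signature_iff hv).2 (Or.inl htop), heven⟩, add_zero]

lemma IsEPair.next_eq {x y : Shape} (hxy : IsEPair x y) (htop : y.isTop = true) (h : ℕ) :
    next h x = h := by
  grind [IsEPair, next, Bool.toNat]

/-- The conditions (a)–(d) for a normalized `E`-permutation on the steps `s` and `s'` inserting
`2 * j - 1` and `2 * j`, the former at height `h`. The signature function exceeds the height by one
at `2 * j - 1` and coincides with it at `2 * j` if the latter is a descent top. -/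
def ENormal (h : ℕ) (s s' : Step) : Prop :=
  (s.1.isBot = true → (Even h → Even s'.2) ∧ (Odd h → Even s.2)) ∧
    (s'.1.isTop = true →
      (Odd h → Even (stepRight false h s)) ∧ (Even h → Even (stepRight false (next h s.1) s')))
deriving Decidable

lemma isNormalizedEPerm_iff {n : ℕ} (σ : Equiv.Perm (Fin (2 * n))) : IsNormalizedEPerm n σ ↔
    ∀ j ∈ range n, IsEPair (step false σ (1 + 2 * j)).1 (step false σ (1 + 2 * j + 1)).1 ∧
      ENormal (height false σ (1 + 2 * j)) (step false σ (1 + 2 * j))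
        (step false σ (1 + 2 * j + 1)) := by
  refine Iff.trans (and_congr_right fun hσ => ?_)
    ((and_congr_left' (isEPerm_iff σ)).trans forall₂_and.symm)
  rw [forall_mem_Icc_one_iff]
  refine forall₂_congr fun j hj => ?_
  rw [show 2 * (j + 1) - 1 = 1 + 2 * j by omega, show 2 * (j + 1) = 1 + 2 * j + 1 by ring]
  have hodd : 1 + 2 * j ∈ Icc 1 (2 * n) := by grind
  have heven : 1 + 2 * j + 1 ∈ Icc 1 (2 * n) := by grind
  have hshape := (isEPerm_iff σ).1 hσ j hj
  have hnext := height_succ (c := false) (σ := σ) hodd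
  have hright : ressAt σ (1 + 2 * j) = _ := rightAt_eq_stepRight (c := false) hodd
  have hright' : ressAt σ (1 + 2 * j + 1) = _ := rightAt_eq_stepRight (c := false) heven
  have hmem := mem_signature_iff (σ := σ) hodd
  have hmem' := mem_signature_iff (σ := σ) heven
  have hsig := sig_eq_of_odd hσ.1 hodd (by grind)
  have hsig' := sig_eq_of_isTop hσ.1 heven
  have hsame := fun htop => hshape.next_eq htop (height false σ (1 + 2 * j))
  have hbot_even : (shape false σ (1 + 2 * j + 1)).isBot = false := by grind [IsEPair]
  have htop_odd : (shape false σ (1 + 2 * j)).isTop = false := by grind [IsEPair]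
  simp only [ENormal, step, hright, hright', hmem, hmem', hnext, hsig, hbot_even, htop_odd]
  grind

lemma exists_entry_eq_iff {P : ℕ → Prop} (hv : v ∈ Icc 1 N) :
    (∃ i ∈ Icc 1 N, entry σ i = v ∧ P i) ↔ P (pos σ v) := by
  simp only [entry_eq_iff hv]
  grind [pos_mem_Icc]

lemma isDoubleDescent_iff (hv : v ∈ Icc 1 N) :
    IsDoubleDescent σ v ↔ shape true σ v = Shape.doubleDescent := by
  rw [IsDoubleDescent, exists_entry_eq_iff hv, entry_pos σ hv]
  simp only [shape, Shape.doubleDescent, Shape.mk.injEq, padded_true, decide_eq_true_eq]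

lemma isPeak_iff_isTop (hv : v ∈ Icc 1 N) (hdouble : ¬ IsDoubleDescent σ v) :
    IsPeak σ v ↔ (shape true σ v).isTop = true := by
  have := entry_eq_iff (σ := σ) (i := pos σ v - 1) hv
  rw [IsDoubleDescent, exists_entry_eq_iff hv, entry_pos σ hv] at hdouble
  rw [IsPeak, exists_entry_eq_iff hv, entry_pos σ hv, isTop_shape_eq_true, padded_true]
  grind [pos_mem_Icc]

lemma isValley_iff_isBot (hv : v ∈ Icc 1 N) (hdouble : ¬ IsDoubleDescent σ v) :
    IsValley σ v ↔ (shape true σ v).isBot = true := by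
  have := entry_eq_iff (σ := σ) (i := pos σ v + 1) hv
  rw [IsDoubleDescent, exists_entry_eq_iff hv, entry_pos σ hv] at hdouble
  rw [IsValley, exists_entry_eq_iff hv, entry_pos σ hv, isBot_shape_eq_true, padded_true]
  grind

lemma isOddOddDescent_and_odd_last_iff (hN : 1 ≤ N) :
    IsOddOddDescent σ ∧ Odd (entry σ N) ↔ ∀ v ∈ Icc 1 N,
      ((shape true σ v).isTop = true → Odd v) ∧ ((shape true σ v).isBot = true → Odd v) := by
  have hbot {v : ℕ} (hv : v ∈ Icc 1 N) := isDescentBottom_iff (σ := σ) true hv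
  have htop {v : ℕ} (hv : v ∈ Icc 1 N) :
      (shape true σ v).isTop = true ↔ IsDescentTop σ v ∨ v = entry σ N := by
    have := entry_eq_iff (σ := σ) (i := N) hv
    rw [IsDescentTop, isTop_shape_eq_true, padded_true]
    grind [pos_mem_Icc, entry_pos, pos_entry, entry_eq_zero_of_notMem]
  have hlast := entry_mem_Icc σ (right_mem_Icc.2 hN)
  unfold IsOddOddDescent
  grind [IsDescentTop, IsDescentBottom, entry_mem_Icc]

lemma isTop_shape_entry_last (hN : 1 ≤ N) : (shape true σ (entry σ N)).isTop = true := by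
  have := entry_mem_Icc σ (right_mem_Icc.2 hN)
  rw [isTop_shape_eq_true, pos_entry σ (right_mem_Icc.2 hN), padded_true,
    entry_eq_zero_of_notMem σ (by simp)]
  grind

lemma isFPerm_iff_forall_shape {n : ℕ} (σ : Equiv.Perm (Fin (2 * n + 1))) :
    IsFPerm n σ ↔ ∀ v ∈ Icc 1 (2 * n),
      (((shape true σ v).isTop = true → Odd v) ∧ ((shape true σ v).isBot = true → Odd v)) ∧
        shape true σ v ≠ Shape.doubleDescent := by
  have hN : 1 ≤ 2 * n + 1 := by omega
  have hlast := entry_mem_Icc σ (right_mem_Icc.2 hN)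
  have hpeak (hdouble : ∀ v ∈ Icc 1 (2 * n + 1), ¬ IsDoubleDescent σ v) :
      IsPeak σ (entry σ (2 * n + 1)) :=
    (isPeak_iff_isTop hlast (hdouble _ hlast)).2 (isTop_shape_entry_last hN)
  have hbot := isBot_shape_last (c := true) (σ := σ)
  have hrestrict {P : ℕ → Prop} (hP : P (2 * n + 1)) :
      (∀ v ∈ Icc 1 (2 * n + 1), P v) ↔ ∀ v ∈ Icc 1 (2 * n), P v := by grind
  have hdouble : (∀ v ∈ Icc 1 (2 * n + 1), ¬ IsDoubleDescent σ v) ↔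
      ∀ v ∈ Icc 1 (2 * n + 1), shape true σ v ≠ Shape.doubleDescent :=
    forall₂_congr fun v hv => not_congr (isDoubleDescent_iff hv)
  rw [IsFPerm, ← and_assoc, isOddOddDescent_and_odd_last_iff hN, and_iff_left_of_imp hpeak,
    hdouble, ← forall₂_and]
  exact hrestrict (by simp [Shape.ext_iff, hbot])

lemma isFPerm_iff {n : ℕ} (σ : Equiv.Perm (Fin (2 * n + 1))) : IsFPerm n σ ↔
    ∀ j ∈ range n, IsFPair (shape true σ (1 + 2 * j)) (shape true σ (1 + 2 * j + 1)) := by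
  rw [isFPerm_iff_forall_shape, forall_mem_Icc_one_two_mul_iff]
  refine forall₂_congr fun j _ => ?_
  have hodd : Odd (1 + 2 * j) := by grind
  have heven : ¬ Odd (1 + 2 * j + 1) := by grind
  simp only [IsFPair, ne_eq, Shape.ext_iff, Shape.doubleDescent_isBot, Shape.doubleDescent_isTop,
    Shape.doubleAscent_isBot, Shape.doubleAscent_isTop, hodd, heven]
  grind

/-- The condition for a normalized `F`-permutation on the steps `s` and `s'` inserting `2 * i - 1`
and `2 * i`, the former at height `h`. -/
def FNormal (h : ℕ) (s s' : Step) : Prop :=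
  s.1.isBot = true ∨ s.1.isTop = true →
    (Even h → Even (stepRight true h s)) ∧ (Odd h → Even s'.2)
deriving Decidable

lemma levelAt_eq_height (hσ : ∀ u ∈ Icc 1 N, ¬ IsDoubleDescent σ u) (hv : v ∈ Icc 1 N) :
    levelAt σ v = height true σ v := by
  have hheight := height_add_card_isTop (c := true) (σ := σ) (v := v) (by simp; grind) (by grind)
  have hvalley : (Icc 1 N).filter (fun u => IsValley σ u ∧ u < v) =
      {u ∈ Ico 1 v | (shape true σ u).isBot = true} := by
    ext u
    have := fun hu => isValley_iff_isBot hu (hσ u hu)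
    simp only [mem_filter]
    grind
  have hpeak : (Icc 1 N).filter (fun u => IsPeak σ u ∧ u < v) =
      {u ∈ Ico 1 v | (shape true σ u).isTop = true} := by
    ext u
    have := fun hu => isPeak_iff_isTop hu (hσ u hu)
    simp only [mem_filter]
    grind
  rw [levelAt, hvalley, hpeak]
  simp only [Bool.toNat_true] at hheight
  omega

lemma isNormalizedFPerm_iff {n : ℕ} (σ : Equiv.Perm (Fin (2 * n + 1))) :
    IsNormalizedFPerm n σ ↔
      ∀ j ∈ range n, IsFPair (step true σ (1 + 2 * j)).1 (step true σ (1 + 2 * j + 1)).1 ∧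
        FNormal (height true σ (1 + 2 * j)) (step true σ (1 + 2 * j))
          (step true σ (1 + 2 * j + 1)) := by
  refine Iff.trans (and_congr_right fun hσ => ?_)
    ((and_congr_left' (isFPerm_iff σ)).trans forall₂_and.symm)
  rw [forall_mem_Icc_one_iff]
  refine forall₂_congr fun j hj => ?_
  have hodd : 1 + 2 * j ∈ Icc 1 (2 * n + 1) := by grind
  have hright : resAt σ (1 + 2 * j) = _ := rightAt_eq_stepRight (c := true) hodd
  have hdouble := hσ.2.2.1 _ hodd
  rw [IsVOP, vopEmbracing, show 2 * (j + 1) - 1 = 1 + 2 * j by omega,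
    show 2 * (j + 1) = 1 + 2 * j + 1 by ring, isValley_iff_isBot hodd hdouble,
    isPeak_iff_isTop hodd hdouble, levelAt_eq_height hσ.2.2.1 hodd, hright]
  simp only [FNormal, step]
  grind

/-! ### Comparison of the weights -/

section Comparison

variable {R : Type*} [CommSemiring R]

open Shape

/-- The total weight of the steps of a given shape that have `m` places to choose from, the place
`i` being allowed if `P i`. If `P` always holds and `a = 1`, this is the `(p, q)`-analogue of the
integer `m`. -/
def bracket (a p q : R) (m : ℕ) (P : ℕ → Prop) [DecidablePred P] : R :=
  ∑ i ∈ range m, if P i then (if i = 0 then a else 1) * p ^ (m - 1 - i) * q ^ i else 0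

lemma pairCoeff_pairWeight {A : ℕ → Step → Step → Prop} [∀ h s s', Decidable (A h s s')]
    {h : ℕ} {x y : Shape} {P Q : ℕ → Prop} [DecidablePred P] [DecidablePred Q]
    (hA : ∀ i j, A h ⟨x, i⟩ ⟨y, j⟩ ↔ P i ∧ Q j) (hy : y.isBot = false) (a p q t : R) :
    pairCoeff c (pairWeight c A a p q t) h x y =
      bracket 1 p q (places c x h) P * bracket a p q (places c y (next h x)) Q *
        t ^ x.isBot.toNat := by
  rw [pairCoeff, bracket, bracket, sum_mul_sum, sum_mul]
  refine sum_congr rfl fun i _ => ?_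
  rw [sum_mul]
  refine sum_congr rfl fun j _ => ?_
  rw [ite_zero_mul_ite_zero, ite_zero_mul]
  simp only [pairWeight, hA, stepWeight, stepRight, hy]
  refine if_congr Iff.rfl ?_ rfl
  simp only [true_and, ite_self, one_mul, Bool.toNat_false, pow_zero, mul_one]
  ring

lemma Xbar_eq_transferSum (n : ℕ) (a p q t : R) : Xbar n a 1 p q t =
    transferSum false (pairWeight false (fun _ s s' => IsEPair s.1 s'.1) a p q t) n 0 := by
  simpa [Xbar] using sum_filter_weight_eq_transferSum (c := false) rfl (IsEPerm n)
    (fun _ s s' => IsEPair s.1 s'.1) isEPerm_iff a p q t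

lemma Xhat_eq_transferSum (n : ℕ) (p q t : R) : Xhat n 1 1 p q t =
    transferSum false
      (pairWeight false (fun h s s' => IsEPair s.1 s'.1 ∧ ENormal h s s') 1 p q t) n 0 := by
  simpa [Xhat] using sum_filter_weight_eq_transferSum (c := false) rfl (IsNormalizedEPerm n)
    (fun h s s' => IsEPair s.1 s'.1 ∧ ENormal h s s') isNormalizedEPerm_iff 1 p q t

lemma Ybar_eq_transferSum (n : ℕ) (a p q t : R) : Ybar n a p q t =
    transferSum true (pairWeight true (fun _ s s' => IsFPair s.1 s'.1) a p q t) n 1 :=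
  sum_filter_weight_eq_transferSum (c := true) rfl (IsFPerm n)
    (fun _ s s' => IsFPair s.1 s'.1) isFPerm_iff a p q t

lemma Yhat_eq_transferSum (n : ℕ) (p q t : R) : Yhat n p q t =
    transferSum true
      (pairWeight true (fun h s s' => IsFPair s.1 s'.1 ∧ FNormal h s s') 1 p q t) n 1 := by
  simpa [Yhat] using sum_filter_weight_eq_transferSum (c := true) rfl (IsNormalizedFPerm n)
    (fun h s s' => IsFPair s.1 s'.1 ∧ FNormal h s s') isNormalizedFPerm_iff 1 p q t

lemma of_pairWeight_ne_zero {A : ℕ → Step → Step → Prop} [∀ h s s', Decidable (A h s s')]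
    {a p q t : R} {h : ℕ} {s s' : Step} (hne : pairWeight c A a p q t h s s' ≠ 0) : A h s s' :=
  of_not_not fun hA => hne (if_neg hA)

lemma pairCoeff_pairWeight_of_shape {T : Shape → Shape → Prop} [DecidableRel T] {x y : Shape}
    (hxy : T x y) (hy : y.isBot = false) (a p q t : R) (h : ℕ) :
    pairCoeff c (pairWeight c (fun _ s s' => T s.1 s'.1) a p q t) h x y =
      bracket 1 p q (places c x h) (fun _ => True) *
        bracket a p q (places c y (next h x)) (fun _ => True) * t ^ x.isBot.toNat :=
  pairCoeff_pairWeight (by simp [hxy]) hy a p q t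

theorem Ybar_eq_Xbar (n : ℕ) (a p q t : R) : Ybar n a p q t = Xbar n a 1 p q t := by
  rw [Ybar_eq_transferSum, Xbar_eq_transferSum,
    transferSum_true_eq_motzkinSum fun _ _ _ => of_pairWeight_ne_zero,
    transferSum_false_eq_motzkinSum fun _ _ _ => of_pairWeight_ne_zero]
  have hE (h : ℕ) {x y : Shape} (hxy : IsEPair x y) :=
    pairCoeff_pairWeight_of_shape (c := false) hxy hxy.2.1 a p q t h
  have hF (h : ℕ) {x y : Shape} (hxy : IsFPair x y) :=
    pairCoeff_pairWeight_of_shape (c := true) hxy (by rw [hxy.2]; rfl) a p q t h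
  refine motzkinSum_congr (fun h => ?_) (fun h => ?_) n
  · rw [hE h (by decide), hF (h + 1) (by decide)]
    rfl
  · rw [hE h (by decide), hE (h + 1) (by decide), hF (h + 1) (by decide), hF (h + 2) (by decide)]
    simp [places, next]

lemma eNormal_valley_doubleAscent_iff (h i j : ℕ) :
    ENormal h ⟨valley, i⟩ ⟨doubleAscent, j⟩ ↔ (Odd h → Even i) ∧ (Even h → Even j) := by
  simp [ENormal, and_comm]

lemma eNormal_doubleAscent_peak_iff (h i j : ℕ) :
    ENormal (h + 1) ⟨doubleAscent, i⟩ ⟨peak, j⟩ ↔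
      (Even h → Even (h + 1 - i)) ∧ (Odd h → Even (h - j)) := by
  simp [ENormal, stepRight, places, next, parity_simps]

lemma fNormal_valley_doubleAscent_iff (h i j : ℕ) :
    FNormal (h + 1) ⟨valley, i⟩ ⟨doubleAscent, j⟩ ↔
      (Odd h → Even (h - i)) ∧ (Even h → Even j) := by
  simp [FNormal, stepRight, places, parity_simps]

lemma fNormal_peak_doubleAscent_iff (h i j : ℕ) :
    FNormal (h + 2) ⟨peak, i⟩ ⟨doubleAscent, j⟩ ↔
      (Even h → Even (h + 1 - i)) ∧ (Odd h → Even j) := by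
  simp [FNormal, stepRight, places, parity_simps]

theorem Yhat_eq_Xhat (n : ℕ) (p q t : R) : Yhat n p q t = Xhat n 1 1 p q t := by
  rw [Yhat_eq_transferSum, Xhat_eq_transferSum,
    transferSum_true_eq_motzkinSum fun _ _ _ hne => (of_pairWeight_ne_zero hne).1,
    transferSum_false_eq_motzkinSum fun _ _ _ hne => (of_pairWeight_ne_zero hne).1]
  refine motzkinSum_congr (fun h => ?_) (fun h => ?_) n
  · rw [pairCoeff_pairWeight (P := fun _ => True) (Q := fun _ => True)
        (by simp [FNormal, IsFPair, Shape.ext_iff]) rfl,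
      pairCoeff_pairWeight (P := fun _ => True) (Q := fun _ => True)
        (by simp [ENormal, IsEPair]) rfl]
    rfl
  · rw [pairCoeff_pairWeight (fun i j =>
        (and_iff_right (by decide : IsFPair valley doubleAscent)).trans
          (fNormal_valley_doubleAscent_iff h i j)) rfl,
      pairCoeff_pairWeight (fun i j =>
        (and_iff_right (by decide : IsFPair peak doubleAscent)).trans
          (fNormal_peak_doubleAscent_iff h i j)) rfl,
      pairCoeff_pairWeight (fun i j =>
        (and_iff_right (by decide : IsEPair valley doubleAscent)).trans
          (eNormal_valley_doubleAscent_iff h i j)) rfl,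
      pairCoeff_pairWeight (fun i j =>
        (and_iff_right (by decide : IsEPair doubleAscent peak)).trans
          (eNormal_doubleAscent_peak_iff h i j)) rfl]
    simp only [places, next, valley_isTop, valley_isBot, doubleAscent_isTop, doubleAscent_isBot,
      peak_isTop, peak_isBot, Bool.false_eq_true, ↓reduceIte, Bool.toNat_true, Bool.toNat_false,
      add_tsub_cancel_right, Nat.add_one_sub_one, tsub_zero, add_zero, pow_one, pow_zero, mul_one]
    ring

end Comparison

end EvenOddDrop

theorem mainTheorem11 {R : Type*} [CommSemiring R] (n : ℕ) (a p q t : R) :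
    EvenOddDrop.Ybar n a p q t = EvenOddDrop.Xbar n a 1 p q t ∧
      EvenOddDrop.Yhat n p q t = EvenOddDrop.Xhat n 1 1 p q t :=
  ⟨EvenOddDrop.Ybar_eq_Xbar n a p q t, EvenOddDrop.Yhat_eq_Xhat n p q t⟩
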